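/- Work in Cantor space $2^\omega$ with the fair-coin measure $\mu$, and for $A,B\in 2^\omega$ let $A\oplus B$ be the sequence with $(A\oplus B)(2n)=A(n)$ and $(A\oplus B)(2n+1)=B(n)$. A basic open set is the empty set or a set $[\sigma]=\{X\in 2^\omega : X \succ \sigma\}$ with $\sigma\in 2^{<\omega}$. A Schnorr test is a sequence $\langle U_n\rangle_{n\in\mathbb N}$ of uniformly $\Sigma^0_1$ subsets of $2^\omega$ (that is, $U_n=\bigcup_s C_{n,s}$ for a computable double sequence $\langle C_{n,s}\rangle$ of basic open sets) such that $\mu(U_n)\le 2^{-n}$ for all $n$ and $\mu(U_n)$ is computable uniformly in $n$. A sequence $X\in 2^\omega$ is Schnorr random if there is no Schnorr test $\langle U_n\rangle$ with $X\in\bigcap_n U_n$. A function $f\in\mathbb N^{\mathbb N}$ encodes a sequence $\langle U_n\rangle$ of open sets with $\mu(U_n)\le 2^{-n}$ if it encodes, for each $n$, a list of basic open sets with union $U_n$ and a sequence $\langle q_k\rangle$ of rationals with limit $\mu(U_n)$ such that $|q_k-q_m|\le 2^{-m}$ for all $k\ge m$. A uniform Schnorr test is a collection $\langle U^X_n\rangle_{n\in\mathbb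 N,\,X\in 2^\omega}$ for which there is a total computable map $\Phi\colon 2^\omega\to\mathbb N^{\mathbb N}$ such that, for every $X\in 2^\omega$, $\Phi(X)$ encodes $\langle U^X_n\rangle_{n\in\mathbb N}$. Say that $B$ is Schnorr random uniformly relative to $A$ if there is no uniform Schnorr test $\langle U^X_n\rangle$ with $B\in\bigcap_n U^A_n$. Theorem. For all $A,B\in 2^\omega$, $A\oplus B$ is Schnorr random if and only if $A$ is Schnorr random and $B$ is Schnorr random uniformly relative to $A$. -/

import Mathlib

open MeasureTheory Filter Topology

namespace SchnorrVL

/-- Cantor space `2^ω`; a set of natural numbers is identified with its characteristic sequence. -/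
abbrev Cantor : Type := ℕ → Bool

/-- The fair-coin measure on `2^ω`: the product of the uniform measures on `{0, 1}`. -/
noncomputable def coinMeasure : Measure Cantor :=
  Measure.infinitePi fun _ : ℕ => (PMF.uniformOfFintype Bool).toMeasure

/-- The initial segment of `X` of length `k`. -/
def initSeg (X : Cantor) (k : ℕ) : List Bool :=
  (List.range k).map X

/-- The set `[σ]` of all `X` that extend the finite string `σ`. -/
def strCylinder (σ : List Bool) : Set Cantor :=
  {X | initSeg X σ.length = σ}

/-- The join `A ⊕ B`: `A` on the even positions and `B` on the odd positions. -/
def cantorJoin (A B : Cantor) : Cantor :=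
  fun n => if n % 2 = 0 then A (n / 2) else B (n / 2)

/-- The basic open sets: the cylinders and the empty set. -/
def basicOpen : Option (List Bool) → Set Cantor
  | none => ∅
  | some σ => strCylinder σ

/-- The basic open set with a given natural number as code. The encoding of `o` is a code of
`basicOpen o`; a number that encodes nothing is one more code of the empty set. -/
def basicOpenOfCode (c : ℕ) : Set Cantor :=
  basicOpen (Encodable.decode (α := Option (List Bool)) c).join

/-- The open set with code `c`, a sequence of (codes of) basic open sets. -/
def openOfCode (c : ℕ → ℕ) : Set Cantor :=
  ⋃ s, basicOpenOfCode (c s)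

/-- The rational number with code `⟨⟨a, b⟩, d⟩`, namely `(a - b) / (d + 1)`. -/
def ratOfCode (c : ℕ) : ℚ :=
  ((c.unpair.1.unpair.1 : ℚ) - (c.unpair.1.unpair.2 : ℚ)) / ((c.unpair.2 : ℚ) + 1)

/-- `q` is (codes rationals that form) a fast Cauchy sequence with limit `x`. -/
def IsFastCauchyCode (q : ℕ → ℕ) (x : ℝ) : Prop :=
  (∀ m n, m ≤ n → |ratOfCode (q n) - ratOfCode (q m)| ≤ (1 / 2 : ℚ) ^ m) ∧
    Tendsto (fun n => ((ratOfCode (q n) : ℚ) : ℝ)) atTop (𝓝 x)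

/-- `U` is a uniform sequence of `Σ⁰₁` subsets of `2^ω`. -/
def UniformlySigma01 (U : ℕ → Set Cantor) : Prop :=
  ∃ c : ℕ → ℕ → ℕ, Computable₂ c ∧ ∀ n, U n = openOfCode (c n)

/-- `x` is a uniformly computable sequence of real numbers. -/
def UniformlyComputable (x : ℕ → ℝ) : Prop :=
  ∃ q : ℕ → ℕ → ℕ, Computable₂ q ∧ ∀ n, IsFastCauchyCode (q n) (x n)

/-- Martin-Löf tests. -/
def IsMartinLofTest (U : ℕ → Set Cantor) : Prop :=
  UniformlySigma01 U ∧ ∀ n, coinMeasure (U n) ≤ (1 / 2) ^ n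

/-- Schnorr tests. -/
def IsSchnorrTest (U : ℕ → Set Cantor) : Prop :=
  IsMartinLofTest U ∧ UniformlyComputable fun n => coinMeasure.real (U n)

/-- `A` is Schnorr random if no Schnorr test covers it. -/
def SchnorrRandom (A : Cantor) : Prop :=
  ¬ ∃ U, IsSchnorrTest U ∧ A ∈ ⋂ n, U n

/-- `f ∈ ℕ^ℕ` encodes the (possibly noncomputable) Schnorr test `U`: its even part lists, for
each `n`, basic open sets with union `U n`, and its odd part gives, for each `n`, a fast Cauchy
sequence of rationals that converges to the measure of `U n`. -/
structure EncodesSchnorrTest (f : ℕ → ℕ) (U : ℕ → Set Cantor) : Prop where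
  open_eq : ∀ n, U n = openOfCode fun s => f (2 * Nat.pair n s)
  measure_le : ∀ n, coinMeasure (U n) ≤ (1 / 2) ^ n
  measure_code : ∀ n,
    IsFastCauchyCode (fun k => f (2 * Nat.pair n k + 1)) (coinMeasure.real (U n))

/-- `Φ : 2^ω → ℕ^ℕ` is a total computable map: some computable procedure `φ`, given a finite
initial segment of the oracle `X` and an argument `n`, either returns a value or asks for more of
the oracle; every value it returns is `Φ X n`, and it does return a value on some initial segment
of each `X`. -/
def TotalComputable (Φ : Cantor → ℕ → ℕ) : Prop :=
  ∃ φ : List Bool → ℕ → Option ℕ, Computable₂ φ ∧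
    ∀ X n, (∃ k, φ (initSeg X k) n = some (Φ X n)) ∧
      ∀ k m, φ (initSeg X k) n = some m → m = Φ X n

/-- The collection `U X n` is a uniform Schnorr test: a total computable map sends each
`X ∈ 2^ω` to a code of the Schnorr test `U X`. -/
def IsUniformSchnorrTest (U : Cantor → ℕ → Set Cantor) : Prop :=
  ∃ Φ : Cantor → ℕ → ℕ, TotalComputable Φ ∧ ∀ X, EncodesSchnorrTest (Φ X) (U X)

/-- `A` is Schnorr random uniformly relative to `B`. -/
def SchnorrRandomUniformlyRel (A B : Cantor) : Prop :=
  ¬ ∃ U, IsUniformSchnorrTest U ∧ A ∈ ⋂ n, U B n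

end SchnorrVL

-- The proof is an effective Fubini argument, given contrapositively in each direction.
--
-- If `A` is not Schnorr random, the clopen sets that capture it are pulled back along the even
-- part. If a uniform test `U` captures `B` relative to `A`, the sets of `Z` whose odd part lies in
-- the section `U (evenPart Z) n` capture the join. By Fubini their measure is the integral of the
-- measures of the sections. Totality matters here: by compactness the use of a total computable map
-- is computably bounded (`TotalComputable.exists_use`), so the integral of the `k`-th rational
-- approximation is a finite mean, and it has error at most `2⁻ᵏ` because every section has
-- (`IsUniformSchnorrTest.isSchnorrTest_join`).
--
-- Conversely, a join that is not Schnorr random lies in infinitely many of a computable sequence of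
-- clopen sets `V m` of measure at most `4⁻ᵐ` (`exists_clopen_of_not_schnorrRandom`). By Markov's
-- inequality, the set of `X` whose section of `V m` has measure above `2⁻ᵐ` has measure at most
-- `2⁻ᵐ`; it is clopen and decidable. If `A` is Schnorr random, it lies in only finitely many of
-- these sets. Replacing the large sections by `∅` bounds the measures for every oracle and still
-- catches `B` infinitely often over `A`. The tail unions of the trimmed sections form a uniform
-- Schnorr test (`isUniformSchnorrTest_tail`).

attribute [fun_prop] Computable Computable.const Computable.pair

/-! ### Closure properties of computable functions -/

namespace Computable

variable {α β γ σ : Type*} [Primcodable α] [Primcodable β] [Primcodable γ] [Primcodable σ]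

@[fun_prop]
theorem id_fun : Computable fun a : α => a := Computable.id

@[fun_prop]
theorem comp_fun {f : β → σ} {g : α → β} (hf : Computable f) (hg : Computable g) :
    Computable fun a => f (g a) :=
  hf.comp hg

@[fun_prop]
theorem fst_fun {f : α → β × γ} (hf : Computable f) : Computable fun a => (f a).1 :=
  Computable.fst.comp hf

@[fun_prop]
theorem snd_fun {f : α → β × γ} (hf : Computable f) : Computable fun a => (f a).2 :=
  Computable.snd.comp hf

@[fun_prop]
theorem nat_add {f g : α → ℕ} (hf : Computable f) (hg : Computable g) :
    Computable fun a => f a + g a :=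
  Primrec.nat_add.to_comp.comp hf hg

@[fun_prop]
theorem nat_sub {f g : α → ℕ} (hf : Computable f) (hg : Computable g) :
    Computable fun a => f a - g a :=
  Primrec.nat_sub.to_comp.comp hf hg

@[fun_prop]
theorem nat_mul {f g : α → ℕ} (hf : Computable f) (hg : Computable g) :
    Computable fun a => f a * g a :=
  Primrec.nat_mul.to_comp.comp hf hg

@[fun_prop]
theorem nat_pow {f g : α → ℕ} (hf : Computable f) (hg : Computable g) :
    Computable fun a => f a ^ g a :=
  (Primrec₂.unpaired'.1 Nat.Primrec.pow).to_comp.comp hf hg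

@[fun_prop]
theorem nat_div {f g : α → ℕ} (hf : Computable f) (hg : Computable g) :
    Computable fun a => f a / g a :=
  Primrec.nat_div.to_comp.comp hf hg

@[fun_prop]
theorem nat_mod {f g : α → ℕ} (hf : Computable f) (hg : Computable g) :
    Computable fun a => f a % g a :=
  Primrec.nat_mod.to_comp.comp hf hg

@[fun_prop]
theorem nat_pair {f g : α → ℕ} (hf : Computable f) (hg : Computable g) :
    Computable fun a => Nat.pair (f a) (g a) :=
  Primrec₂.natPair.to_comp.comp hf hg

@[fun_prop]
theorem nat_unpair {f : α → ℕ} (hf : Computable f) : Computable fun a => Nat.unpair (f a) :=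
  Computable.unpair.comp hf

@[fun_prop]
theorem decide_nat_lt {f g : α → ℕ} (hf : Computable f) (hg : Computable g) :
    Computable fun a => decide (f a < g a) :=
  Primrec.nat_lt.decide.to_comp.comp hf hg

@[fun_prop]
theorem decide_nat_le {f g : α → ℕ} (hf : Computable f) (hg : Computable g) :
    Computable fun a => decide (f a ≤ g a) :=
  Primrec.nat_le.decide.to_comp.comp hf hg

@[fun_prop]
theorem decide_eq [DecidableEq β] {f g : α → β} (hf : Computable f) (hg : Computable g) :
    Computable fun a => decide (f a = g a) :=
  (Primrec.eq (α := β)).decide.to_comp.comp hf hg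

@[fun_prop]
theorem bool_and {f g : α → Bool} (hf : Computable f) (hg : Computable g) :
    Computable fun a => f a && g a :=
  Primrec.and.to_comp.comp hf hg

@[fun_prop]
theorem bool_or {f g : α → Bool} (hf : Computable f) (hg : Computable g) :
    Computable fun a => f a || g a :=
  Primrec.or.to_comp.comp hf hg

@[fun_prop]
theorem bool_not {f : α → Bool} (hf : Computable f) : Computable fun a => !f a :=
  Primrec.not.to_comp.comp hf

attribute [fun_prop] Computable.cond

@[fun_prop]
theorem bool_toNat {f : α → Bool} (hf : Computable f) : Computable fun a => (f a).toNat :=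
  (Computable.cond hf (const 1) (const 0)).of_eq fun a => by cases f a <;> rfl

@[fun_prop]
theorem list_take {f : α → ℕ} {g : α → List β} (hf : Computable f) (hg : Computable g) :
    Computable fun a => (g a).take (f a) :=
  Primrec.list_take.to_comp.comp hf hg

@[fun_prop]
theorem list_length_fun {f : α → List β} (hf : Computable f) :
    Computable fun a => (f a).length :=
  Computable.list_length.comp hf

@[fun_prop]
theorem list_getD {f : α → List β} {g : α → ℕ} (hf : Computable f) (hg : Computable g) (d : β) :
    Computable fun a => (f a).getD (g a) d :=
  (Primrec.list_getD d).to_comp.comp hf hg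

@[fun_prop]
theorem encode_fun {f : α → β} (hf : Computable f) : Computable fun a => Encodable.encode (f a) :=
  Computable.encode.comp hf

@[fun_prop]
theorem decode_fun {f : α → ℕ} (hf : Computable f) :
    Computable fun a => (Encodable.decode (f a) : Option β) :=
  Computable.decode.comp hf

@[fun_prop]
theorem some_fun {f : α → β} (hf : Computable f) : Computable fun a => some (f a) :=
  Computable.option_some.comp hf

@[fun_prop]
theorem option_join {f : α → Option (Option β)} (hf : Computable f) :
    Computable fun a => (f a).join :=
  (Computable.option_bind hf (g := fun _ o => o) Computable.snd).of_eq fun a => by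
    cases f a <;> rfl

@[fun_prop]
theorem option_elim {f : α → Option β} {g : α → σ} {h : α → β → σ} (hf : Computable f)
    (hg : Computable g) (hh : Computable fun x : α × β => h x.1 x.2) :
    Computable fun a => (f a).elim (g a) (h a) :=
  (Computable.option_casesOn hf hg hh).of_eq fun a => by cases f a <;> rfl

attribute [fun_prop] Computable.option_getD

@[fun_prop]
theorem option_isSome {f : α → Option β} (hf : Computable f) : Computable fun a => (f a).isSome :=
  Primrec.option_isSome.to_comp.comp hf

@[fun_prop]
theorem nat_rec_fun {f : α → ℕ} {g : α → σ} {h : α → ℕ → σ → σ} (hf : Computable f)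
    (hg : Computable g) (hh : Computable fun x : α × ℕ × σ => h x.1 x.2.1 x.2.2) :
    Computable fun a => Nat.rec (motive := fun _ => σ) (g a) (h a) (f a) :=
  Computable.nat_rec (h := fun a x => h a x.1 x.2) hf hg hh

@[fun_prop]
theorem nat_sum {f : α → ℕ} {g : α → ℕ → ℕ} (hf : Computable f)
    (hg : Computable fun x : α × ℕ => g x.1 x.2) :
    Computable fun a => ∑ i ∈ Finset.range (f a), g a i := by
  refine (nat_rec_fun (g := fun _ => 0) (h := fun a i y => y + g a i) hf (by fun_prop)
    (by fun_prop)).of_eq fun a => ?_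
  induction f a <;> simp [Finset.sum_range_succ, *]

@[fun_prop]
theorem range_any {f : α → ℕ} {g : α → ℕ → Bool} (hf : Computable f)
    (hg : Computable fun x : α × ℕ => g x.1 x.2) :
    Computable fun a => (List.range (f a)).any (g a) := by
  refine (nat_rec_fun (g := fun _ => false) (h := fun a i y => y || g a i) hf (by fun_prop)
    (by fun_prop)).of_eq fun a => ?_
  induction f a <;> simp [List.range_succ, *]

@[fun_prop]
theorem range_all {f : α → ℕ} {g : α → ℕ → Bool} (hf : Computable f)
    (hg : Computable fun x : α × ℕ => g x.1 x.2) :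
    Computable fun a => (List.range (f a)).all (g a) := by
  refine (nat_rec_fun (g := fun _ => true) (h := fun a i y => y && g a i) hf (by fun_prop)
    (by fun_prop)).of_eq fun a => ?_
  induction f a <;> simp [List.range_succ, *]

@[fun_prop]
theorem range_map {f : α → ℕ} {g : α → ℕ → β} (hf : Computable f)
    (hg : Computable fun x : α × ℕ => g x.1 x.2) :
    Computable fun a => (List.range (f a)).map (g a) := by
  refine (nat_rec_fun (g := fun _ => []) (h := fun a i y => y ++ [g a i]) hf (by fun_prop)
    (Computable.list_concat.comp (by fun_prop) (by fun_prop))).of_eq fun a => ?_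
  induction f a <;> simp [List.range_succ, *]

/-- Unbounded search for a decidable witness. It supplies the computable stages, oracle lengths and
use bounds chosen below. -/
theorem exists_search {p : α → ℕ → Bool} (hp : Computable fun x : α × ℕ => p x.1 x.2)
    (h : ∀ a, ∃ n, p a n = true) : ∃ f : α → ℕ, Computable f ∧ ∀ a, p a (f a) = true := by
  refine ⟨fun a => Nat.find (h a), Computable.find ?_ h, fun a => Nat.find_spec (h a)⟩
  exact ⟨inferInstance, hp.of_eq fun a => by simp⟩

@[fun_prop]
theorem nat_testBit {f g : α → ℕ} (hf : Computable f) (hg : Computable g) :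
    Computable fun a => (f a).testBit (g a) :=
  (show Computable fun a => decide (f a / 2 ^ g a % 2 = 1) by fun_prop).of_eq fun a => by
    rw [Nat.testBit_eq_decide_div_mod_eq]

end Computable

/-! ### Initial segments and finite strings -/

namespace SchnorrVL

variable {α : Type*} [Primcodable α]

@[fun_prop]
theorem computable_initSeg {X : α → ℕ → Bool} {k : α → ℕ}
    (hX : Computable fun x : α × ℕ => X x.1 x.2) (hk : Computable k) :
    Computable fun a => initSeg (X a) (k a) := by
  unfold initSeg
  fun_prop

@[simp]
theorem length_initSeg (X : Cantor) (k : ℕ) : (initSeg X k).length = k := by simp [initSeg]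

theorem initSeg_congr {X Y : Cantor} {k : ℕ} : initSeg X k = initSeg Y k ↔ ∀ i < k, X i = Y i := by
  simp [initSeg]

theorem take_initSeg (X : Cantor) (j k : ℕ) : (initSeg X k).take j = initSeg X (min j k) := by
  simp [initSeg, ← List.map_take, List.take_range]

/-- The infinite sequence that continues a string with zeros. -/
def extend (σ : List Bool) : Cantor := fun i => σ.getD i false

@[fun_prop]
theorem computable_extend {f : α → List Bool} {g : α → ℕ} (hf : Computable f)
    (hg : Computable g) : Computable fun a => extend (f a) (g a) := by
  unfold extend
  fun_prop

theorem extend_initSeg (X : Cantor) {i k : ℕ} (h : i < k) : extend (initSeg X k) i = X i := by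
  simp [extend, initSeg, h]

theorem initSeg_extend (σ : List Bool) : initSeg (extend σ) σ.length = σ := by
  apply List.ext_getElem <;> simp +contextual [initSeg, extend]

/-- The `i`-th string of length `L`, for `i < 2 ^ L`. -/
def bitStr (L i : ℕ) : List Bool := initSeg i.testBit L

@[fun_prop]
theorem computable_bitStr {f g : α → ℕ} (hf : Computable f) (hg : Computable g) :
    Computable fun a => bitStr (f a) (g a) := by
  unfold bitStr
  fun_prop

@[simp]
theorem length_bitStr (L i : ℕ) : (bitStr L i).length = L := length_initSeg _ _

theorem bitStr_injOn {L i j : ℕ} (hi : i < 2 ^ L) (hj : j < 2 ^ L) (h : bitStr L i = bitStr L j) :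
    i = j := by
  refine Nat.eq_of_testBit_eq fun b => ?_
  by_cases hb : b < L
  · exact initSeg_congr.1 h b hb
  · have : 2 ^ L ≤ 2 ^ b := Nat.pow_le_pow_right (by norm_num) (not_lt.1 hb)
    rw [Nat.testBit_lt_two_pow (by omega), Nat.testBit_lt_two_pow (by omega)]

theorem exists_bitStr_eq (X : Cantor) (L : ℕ) : ∃ i < 2 ^ L, bitStr L i = initSeg X L := by
  refine ⟨Nat.ofBits fun i : Fin L => X i, Nat.ofBits_lt_two_pow _, ?_⟩
  exact initSeg_congr.2 fun i hi => by simp [hi]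

/-! ### The coin measure and finite averages -/

instance : IsProbabilityMeasure coinMeasure := by
  unfold coinMeasure
  infer_instance

theorem isOpen_setOf_initSeg (P : List Bool → Prop) (L : ℕ) : IsOpen {X | P (initSeg X L)} := by
  have hc : Continuous fun (X : Cantor) (i : Fin L) => X i := by fun_prop
  convert! (isOpen_discrete {f : Fin L → Bool | P (List.ofFn f)}).preimage hc using 1
  ext X
  simp [initSeg, List.ofFn_eq_map, ← List.map_coe_finRange_eq_range, Function.comp_def]

theorem measurableSet_setOf_initSeg (P : List Bool → Prop) (L : ℕ) :
    MeasurableSet {X | P (initSeg X L)} :=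
  (isOpen_setOf_initSeg P L).measurableSet

theorem isOpen_strCylinder (σ : List Bool) : IsOpen (strCylinder σ) :=
  isOpen_setOf_initSeg (· = σ) σ.length

theorem coinMeasure_strCylinder (σ : List Bool) :
    coinMeasure (strCylinder σ) = (1 / 2) ^ σ.length := by
  have h : strCylinder σ = Set.pi (Finset.range σ.length) fun i => {extend σ i} := by
    ext X
    have := initSeg_congr (X := X) (Y := extend σ) (k := σ.length)
    rw [initSeg_extend] at this
    simp [strCylinder, this]
  rw [h, coinMeasure, Measure.infinitePi_pi _ fun _ _ => MeasurableSet.singleton _]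
  simp

theorem isOpen_openOfCode (c : ℕ → ℕ) : IsOpen (openOfCode c) := by
  refine isOpen_iUnion fun s => ?_
  unfold basicOpenOfCode
  cases (Encodable.decode (α := Option (List Bool)) (c s)).join with
  | none => exact isOpen_empty
  | some σ => exact isOpen_strCylinder σ

/-- The cylinders of the strings of length `L` partition the space, so only one term can be nonzero
at `X`. This turns integrals of functions of finitely many bits into finite means. -/
theorem comp_initSeg_eq_sum (g : List Bool → ℝ) (L : ℕ) (X : Cantor) :
    g (initSeg X L) = ∑ i ∈ Finset.range (2 ^ L),
      (strCylinder (bitStr L i)).indicator (fun _ => g (bitStr L i)) X := by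
  obtain ⟨i, hi, h⟩ := exists_bitStr_eq X L
  rw [Finset.sum_eq_single i]
  · rw [Set.indicator_of_mem (by simp [strCylinder, h]), h]
  · intro j hj hji
    refine Set.indicator_of_notMem (fun hX => hji ?_) _
    simp only [strCylinder, length_bitStr, Set.mem_ofPred_eq] at hX
    exact bitStr_injOn (Finset.mem_range.1 hj) hi (by rw [← hX, h])
  · simp [hi]

theorem integrable_comp_initSeg (g : List Bool → ℝ) (L : ℕ) :
    Integrable (fun X => g (initSeg X L)) coinMeasure := by
  simp_rw [comp_initSeg_eq_sum g L]
  exact integrable_finsetSum _ fun i _ =>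
    (integrable_const _).indicator (isOpen_strCylinder _).measurableSet

theorem integral_comp_initSeg (g : List Bool → ℝ) (L : ℕ) :
    ∫ X, g (initSeg X L) ∂coinMeasure =
      (∑ i ∈ Finset.range (2 ^ L), g (bitStr L i)) / 2 ^ L := by
  simp_rw [comp_initSeg_eq_sum g L]
  rw [integral_finsetSum _ fun i _ =>
    (integrable_const _).indicator (isOpen_strCylinder _).measurableSet, Finset.sum_div]
  refine Finset.sum_congr rfl fun i _ => ?_
  rw [integral_indicator_const _ (isOpen_strCylinder _).measurableSet, measureReal_def,
    coinMeasure_strCylinder]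
  simp [div_eq_inv_mul]

/-- The number of strings of length `L` that satisfy `p`. -/
def countStr (p : List Bool → Bool) (L : ℕ) : ℕ :=
  ∑ i ∈ Finset.range (2 ^ L), (p (bitStr L i)).toNat

@[fun_prop]
theorem computable_countStr {α : Type*} [Primcodable α] {p : α → List Bool → Bool} {L : α → ℕ}
    (hp : Computable fun x : α × List Bool => p x.1 x.2) (hL : Computable L) :
    Computable fun a => countStr (p a) (L a) := by
  unfold countStr
  fun_prop

theorem coinMeasure_real_setOf_initSeg (p : List Bool → Bool) (L : ℕ) :
    coinMeasure.real {X | p (initSeg X L) = true} = countStr p L / 2 ^ L := by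
  have h := integral_comp_initSeg (fun σ => ((p σ).toNat : ℝ)) L
  rw [countStr, Nat.cast_sum, ← h,
    ← integral_indicator_one (measurableSet_setOf_initSeg (fun σ => p σ = true) L)]
  refine integral_congr_ae (ae_of_all _ fun X => ?_)
  by_cases hX : p (initSeg X L) = true <;> simp [Set.indicator, hX]

/-! ### The join as a measure-preserving map -/

theorem measurable_cantorJoin : Measurable fun z : Cantor × Cantor => cantorJoin z.1 z.2 := by
  refine measurable_pi_lambda _ fun n => ?_
  unfold cantorJoin
  by_cases h : n % 2 = 0 <;> simp only [h, if_true, if_false] <;> fun_prop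

/-- The even part of a sequence. -/
def evenPart (Z : Cantor) : Cantor := fun n => Z (2 * n)

/-- The odd part of a sequence. -/
def oddPart (Z : Cantor) : Cantor := fun n => Z (2 * n + 1)

@[simp]
theorem evenPart_cantorJoin (X Y : Cantor) : evenPart (cantorJoin X Y) = X := by
  ext n; simp [evenPart, cantorJoin]

@[simp]
theorem oddPart_cantorJoin (X Y : Cantor) : oddPart (cantorJoin X Y) = Y := by
  ext n
  have : (2 * n + 1) / 2 = n := by omega
  simp [oddPart, cantorJoin, this]

/-- A product measure is determined by its values on boxes, and the preimage of a box is the product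
of the box of its even coordinates and the box of its odd ones. -/
theorem measurePreserving_cantorJoin :
    MeasurePreserving (fun z : Cantor × Cantor => cantorJoin z.1 z.2)
      (coinMeasure.prod coinMeasure) coinMeasure := by
  refine ⟨measurable_cantorJoin, ?_⟩
  conv_rhs => rw [coinMeasure]
  refine Measure.eq_infinitePi _ fun s t ht => ?_
  rw [Measure.map_apply measurable_cantorJoin
    (MeasurableSet.pi s.countable_toSet fun i _ => ht i)]
  set e := s.filter (· % 2 = 0) with he
  set o := s.filter (¬ · % 2 = 0) with ho
  have h : (fun z : Cantor × Cantor => cantorJoin z.1 z.2) ⁻¹' Set.pi s t =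
      (Set.pi (e.image (· / 2)) fun i => t (2 * i)) ×ˢ
        (Set.pi (o.image (· / 2)) fun i => t (2 * i + 1)) := by
    ext ⟨X, Y⟩
    simp only [Set.mem_preimage, Set.mem_pi, Finset.mem_coe, Set.mem_prod, Finset.mem_image,
      he, ho, Finset.mem_filter, cantorJoin]
    constructor
    · intro H
      constructor
      · rintro _ ⟨n, ⟨hn, hn2⟩, rfl⟩
        have := H n hn
        rw [if_pos hn2] at this
        rwa [show 2 * (n / 2) = n by omega]
      · rintro _ ⟨n, ⟨hn, hn2⟩, rfl⟩
        have := H n hn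
        rw [if_neg hn2] at this
        rwa [show 2 * (n / 2) + 1 = n by omega]
    · rintro ⟨H1, H2⟩ n hn
      by_cases hn2 : n % 2 = 0
      · have := H1 (n / 2) ⟨n, ⟨hn, hn2⟩, rfl⟩
        rw [if_pos hn2]
        rwa [show 2 * (n / 2) = n by omega] at this
      · have := H2 (n / 2) ⟨n, ⟨hn, hn2⟩, rfl⟩
        rw [if_neg hn2]
        rwa [show 2 * (n / 2) + 1 = n by omega] at this
  rw [h, Measure.prod_prod, coinMeasure, Measure.infinitePi_pi _ fun i _ => ht _,
    Measure.infinitePi_pi _ fun i _ => ht _, ← Finset.prod_filter_mul_prod_filter_not s (· % 2 = 0),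
    Finset.prod_image, Finset.prod_image]
  · congr 1
    · refine Finset.prod_congr rfl fun n hn => ?_
      rw [show 2 * (n / 2) = n by have := (Finset.mem_filter.1 hn).2; omega]
    · refine Finset.prod_congr rfl fun n hn => ?_
      rw [show 2 * (n / 2) + 1 = n by have := (Finset.mem_filter.1 hn).2; omega]
  -- Halving is injective on positions of the same parity, as `Finset.prod_image` requires.
  · intro a ha b hb hab
    have h1 := (Finset.mem_filter.1 ha).2
    have h2 := (Finset.mem_filter.1 hb).2
    simp only at hab
    omega
  · intro a ha b hb hab
    have h1 := (Finset.mem_filter.1 ha).2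
    have h2 := (Finset.mem_filter.1 hb).2
    simp only at hab
    omega

/-! ### Bounded use, geometric tails and fast convergence -/

/-- The procedure waits for `v i` bits and then truncates to them, so a longer oracle segment cannot
change the value. -/
theorem totalComputable_of_initSeg {v : ℕ → ℕ} {ψ : ℕ → List Bool → ℕ} (hv : Computable v)
    (hψ : Computable fun x : ℕ × List Bool => ψ x.1 x.2) :
    TotalComputable fun X i => ψ i (initSeg X (v i)) := by
  refine ⟨fun σ i => bif decide (v i ≤ σ.length) then some (ψ i (σ.take (v i))) else none,
    show Computable fun x : List Bool × ℕ => bif decide (v x.2 ≤ x.1.length) then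
      some (ψ x.2 (x.1.take (v x.2))) else none by fun_prop,
    fun X i => ⟨⟨v i, ?_⟩, fun k m h => ?_⟩⟩
  · simp [take_initSeg]
  · by_cases hk : v i ≤ k
    · simp only [length_initSeg, hk, decide_true, cond_true, take_initSeg, min_eq_left,
        Option.some.injEq] at h
      exact h.symm
    · simp [hk] at h

theorem measure_iUnion_le_half_pow {S : ℕ → Set Cantor} {a : ℕ}
    (h : ∀ j, coinMeasure (S j) ≤ (1 / 2) ^ (a + 1 + j)) :
    coinMeasure (⋃ j, S j) ≤ (1 / 2) ^ a := by
  refine (measure_iUnion_le _).trans ((ENNReal.tsum_le_tsum h).trans_eq ?_)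
  simp_rw [pow_add]
  rw [ENNReal.tsum_mul_left, ENNReal.tsum_geometric, one_div, ENNReal.one_sub_inv_two, inv_inv,
    mul_assoc, pow_one, ENNReal.inv_mul_cancel (by norm_num) (by norm_num), mul_one]

/-- Approximation from below: for `m ≤ n`, the `n`-th term lies between the `m`-th term and `x`, an
interval of length at most `2⁻ᵐ`. -/
theorem isFastCauchyCode_of_monotone {q : ℕ → ℕ} {x : ℝ}
    (hmono : ∀ m n, m ≤ n → ratOfCode (q m) ≤ ratOfCode (q n))
    (hle : ∀ k, (ratOfCode (q k) : ℝ) ≤ x) (hge : ∀ k, x ≤ ratOfCode (q k) + (1 / 2) ^ k) :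
    IsFastCauchyCode q x := by
  constructor
  · intro m n hmn
    rw [abs_of_nonneg (sub_nonneg.2 (hmono m n hmn)), ← Rat.cast_le (K := ℝ)]
    push_cast
    linarith [hle n, hge m]
  · refine tendsto_of_tendsto_of_tendsto_of_le_of_le
      (g := fun k => x - (1 / 2) ^ k) (h := fun _ => x) ?_ tendsto_const_nhds (fun k => ?_) hle
    · simpa using tendsto_const_nhds.sub
        (tendsto_pow_atTop_nhds_zero_of_lt_one (r := (1 / 2 : ℝ)) (by norm_num) (by norm_num))
    · simp only
      linarith [hge k]

theorem ratOfCode_count (c L : ℕ) :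
    (ratOfCode (Nat.pair (Nat.pair c 0) (2 ^ L - 1)) : ℝ) = c / 2 ^ L := by
  simp [ratOfCode]

/-! ### Tail unions of clopen sections as a uniform Schnorr test -/

section BorelCantelli

variable (u : ℕ → ℕ) (p : ℕ → List Bool → List Bool → Bool)

/-- The section at `X` of the `m`-th clopen set described by `p`, with use bounded by `u`. -/
def clopenSection (X : Cantor) (m : ℕ) : Set Cantor :=
  {Y | p m (initSeg X (u m)) (initSeg Y (u m)) = true}

/-- Decides whether a string lies in one of the sections with index in `[n + 1, n + 1 + k]`. -/
def partialUnionTest (n k : ℕ) (α τ : List Bool) : Bool :=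
  (List.range (k + 1)).any fun j =>
    p (n + 1 + j) (α.take (u (n + 1 + j))) (τ.take (u (n + 1 + j)))

/-- A common bound for the use of the sections with index in `[n + 1, n + 1 + k]`. -/
def partialUnionUse (n k : ℕ) : ℕ := ∑ j ∈ Finset.range (k + 1), u (n + 1 + j)

/-- The code of the basic open set at position `s` in the list for the tail union from `n`. -/
def tailOpenCode (n s : ℕ) (α : List Bool) : ℕ :=
  bif decide (n < s.unpair.1) &&
      (decide (((Encodable.decode s.unpair.2 : Option (List Bool)).getD []).length =
        u s.unpair.1) &&
      p s.unpair.1 (α.take (u s.unpair.1)) ((Encodable.decode s.unpair.2).getD []))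
    then Encodable.encode (some ((Encodable.decode s.unpair.2 : Option (List Bool)).getD []))
    else Encodable.encode (none : Option (List Bool))

/-- The code of the `k`-th approximation to the measure of the tail union from `n`. -/
def tailMeasureCode (n k : ℕ) (α : List Bool) : ℕ :=
  Nat.pair (Nat.pair (countStr (partialUnionTest u p n k α) (partialUnionUse u n k)) 0)
    (2 ^ partialUnionUse u n k - 1)

/-- The code of the test that consists of the tail unions. -/
def tailTestCode (i : ℕ) (α : List Bool) : ℕ :=
  bif decide (i % 2 = 0) then tailOpenCode u p (i / 2).unpair.1 (i / 2).unpair.2 α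
  else tailMeasureCode u p (i / 2).unpair.1 (i / 2).unpair.2 α

/-- A bound for the use of `tailTestCode`. -/
def tailTestUse (i : ℕ) : ℕ :=
  u (i / 2).unpair.2.unpair.1 + partialUnionUse u (i / 2).unpair.1 (i / 2).unpair.2

variable {u p}

section

variable {α : Type*} [Primcodable α] {f g : α → ℕ} {h k : α → List Bool}

@[fun_prop]
theorem computable_partialUnionUse (hu : Computable u) (hf : Computable f) (hg : Computable g) :
    Computable fun a => partialUnionUse u (f a) (g a) := by
  unfold partialUnionUse
  fun_prop

@[fun_prop]
theorem computable_partialUnionTest (hu : Computable u)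
    (hp : Computable fun x : ℕ × List Bool × List Bool => p x.1 x.2.1 x.2.2)
    (hf : Computable f) (hg : Computable g) (hh : Computable h) (hk : Computable k) :
    Computable fun a => partialUnionTest u p (f a) (g a) (h a) (k a) := by
  unfold partialUnionTest
  fun_prop

@[fun_prop]
theorem computable_tailOpenCode (hu : Computable u)
    (hp : Computable fun x : ℕ × List Bool × List Bool => p x.1 x.2.1 x.2.2)
    (hf : Computable f) (hg : Computable g) (hh : Computable h) :
    Computable fun a => tailOpenCode u p (f a) (g a) (h a) := by
  have hd : Computable fun a =>
      (Encodable.decode (g a).unpair.2 : Option (List Bool)).getD [] := by fun_prop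
  unfold tailOpenCode
  fun_prop

@[fun_prop]
theorem computable_tailMeasureCode (hu : Computable u)
    (hp : Computable fun x : ℕ × List Bool × List Bool => p x.1 x.2.1 x.2.2)
    (hf : Computable f) (hg : Computable g) (hh : Computable h) :
    Computable fun a => tailMeasureCode u p (f a) (g a) (h a) := by
  have hc : Computable fun a =>
      countStr (partialUnionTest u p (f a) (g a) (h a)) (partialUnionUse u (f a) (g a)) := by
    fun_prop
  unfold tailMeasureCode
  fun_prop

end

theorem computable_tailTestUse (hu : Computable u) : Computable (tailTestUse u) := by
  unfold tailTestUse
  fun_prop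

theorem computable_tailTestCode (hu : Computable u)
    (hp : Computable fun x : ℕ × List Bool × List Bool => p x.1 x.2.1 x.2.2) :
    Computable fun x : ℕ × List Bool => tailTestCode u p x.1 x.2 := by
  unfold tailTestCode
  fun_prop

theorem le_partialUnionUse (n : ℕ) {j k : ℕ} (h : j < k + 1) :
    u (n + 1 + j) ≤ partialUnionUse u n k :=
  Finset.single_le_sum (f := fun j => u (n + 1 + j)) (fun _ _ => Nat.zero_le _)
    (Finset.mem_range.2 h)

theorem ratOfCode_tailMeasureCode (X : Cantor) (n k : ℕ) {v : ℕ}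
    (hv : partialUnionUse u n k ≤ v) :
    (ratOfCode (tailMeasureCode u p n k (initSeg X v)) : ℝ) =
      coinMeasure.real (⋃ j ∈ Finset.range (k + 1), clopenSection u p X (n + 1 + j)) := by
  rw [tailMeasureCode, ratOfCode_count, ← coinMeasure_real_setOf_initSeg]
  congr 1
  ext Y
  simp only [partialUnionTest, List.any_eq_true, List.mem_range, Set.mem_ofPred_eq,
    Set.mem_iUnion, Finset.mem_range, clopenSection, exists_prop]
  refine exists_congr fun j => and_congr_right fun hj => ?_
  have := le_partialUnionUse (u := u) n hj
  rw [take_initSeg, take_initSeg, min_eq_left (this.trans hv), min_eq_left this]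

/-- A position `s` stands for a pair of an index `m` and a string. The `m`-th section is the union
of the cylinders of those strings of length `u m` that pass the test. -/
theorem openOfCode_tailOpenCode (X : Cantor) (n : ℕ) {v : ℕ → ℕ}
    (hv : ∀ s, u s.unpair.1 ≤ v s) :
    ⋃ j, clopenSection u p X (n + 1 + j) =
      openOfCode fun s => tailOpenCode u p n s (initSeg X (v s)) := by
  ext Y
  simp only [Set.mem_iUnion, openOfCode, tailOpenCode]
  constructor
  · rintro ⟨j, hj⟩
    refine ⟨Nat.pair (n + 1 + j) (Encodable.encode (initSeg Y (u (n + 1 + j)))), ?_⟩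
    have h := hv (Nat.pair (n + 1 + j) (Encodable.encode (initSeg Y (u (n + 1 + j)))))
    simp only [Nat.unpair_pair] at h
    have h2 : n < n + 1 + j := by omega
    simp only [clopenSection, Set.mem_ofPred_eq] at hj
    simp [take_initSeg, min_eq_left h, h2, hj, basicOpenOfCode, basicOpen, strCylinder]
  · rintro ⟨s, hs⟩
    have h := hv s
    -- If nothing is decoded, `τ` is the empty string. This is harmless, since `τ` is listed only
    -- after passing the same tests as any other string.
    set τ := (Encodable.decode s.unpair.2 : Option (List Bool)).getD [] with hτ
    rw [take_initSeg, min_eq_left h] at hs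
    cases hb : decide (n < s.unpair.1) && (decide (τ.length = u s.unpair.1) &&
        p s.unpair.1 (initSeg X (u s.unpair.1)) τ) with
    | false =>
      rw [hb] at hs
      simp [basicOpenOfCode, basicOpen] at hs
    | true =>
      rw [hb] at hs
      simp only [Bool.and_eq_true, decide_eq_true_eq] at hb
      obtain ⟨h1, h2, h3⟩ := hb
      refine ⟨s.unpair.1 - (n + 1), ?_⟩
      rw [show n + 1 + (s.unpair.1 - (n + 1)) = s.unpair.1 by omega]
      simp only [basicOpenOfCode, basicOpen, cond_true, Encodable.encodek, Option.join_some,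
        strCylinder, Set.mem_ofPred_eq, h2] at hs
      simpa [clopenSection, hs] using h3

/-- Finite unions of sections are clopen with dyadic measure computed by counting strings, and the
geometric bound controls the rest. Since `hμ` holds for every oracle, the rate of convergence is the
same for all of them. -/
theorem isUniformSchnorrTest_tail (hu : Computable u)
    (hp : Computable fun x : ℕ × List Bool × List Bool => p x.1 x.2.1 x.2.2)
    (hμ : ∀ X m, coinMeasure (clopenSection u p X m) ≤ (1 / 2) ^ m) :
    IsUniformSchnorrTest fun X n => ⋃ j, clopenSection u p X (n + 1 + j) := by
  refine ⟨_, totalComputable_of_initSeg (computable_tailTestUse hu)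
    (computable_tailTestCode hu hp), fun X => ⟨fun n => ?_, fun n => ?_, fun n => ?_⟩⟩
  · convert! openOfCode_tailOpenCode X n (v := fun s => tailTestUse u (2 * Nat.pair n s)) ?_ using 3
    · simp [tailTestCode]
    · intro s
      simp [tailTestUse]
  · exact measure_iUnion_le_half_pow fun j => hμ X _
  · have hq : ∀ k, (ratOfCode (tailTestCode u p (2 * Nat.pair n k + 1)
        (initSeg X (tailTestUse u (2 * Nat.pair n k + 1)))) : ℝ) =
        coinMeasure.real (⋃ j ∈ Finset.range (k + 1), clopenSection u p X (n + 1 + j)) := by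
      intro k
      have hdiv : (2 * Nat.pair n k + 1) / 2 = Nat.pair n k := by omega
      have hmod : ¬ (2 * Nat.pair n k + 1) % 2 = 0 := by omega
      rw [← ratOfCode_tailMeasureCode X n k (v := tailTestUse u (2 * Nat.pair n k + 1))]
      · simp only [tailTestCode, hmod, hdiv, decide_false, cond_false, Nat.unpair_pair]
      · simp [tailTestUse, hdiv]
    refine isFastCauchyCode_of_monotone (fun k l hkl => ?_) (fun k => ?_) fun k => ?_
    · rw [← Rat.cast_le (K := ℝ), hq, hq]
      refine measureReal_mono (Set.biUnion_subset_biUnion_left fun j hj => ?_)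
        (measure_ne_top _ _)
      simp only [Finset.coe_range, Set.mem_Iio] at hj ⊢
      omega
    · rw [hq]
      exact measureReal_mono (Set.iUnion₂_subset fun j _ =>
        Set.subset_iUnion (fun j => clopenSection u p X (n + 1 + j)) j)
    · rw [hq]
      -- The sections left out have index at least `n + k + 2`, so together they have measure at
      -- most `2 ^ (-(n + k + 1))`, which is below `2⁻ᵏ`.
      have hsub : ⋃ j, clopenSection u p X (n + 1 + j) ⊆
          (⋃ j ∈ Finset.range (k + 1), clopenSection u p X (n + 1 + j)) ∪
            ⋃ j, clopenSection u p X (n + k + 1 + 1 + j) := by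
        refine Set.iUnion_subset fun j Y hY => ?_
        by_cases hj : j < k + 1
        · exact Or.inl (Set.mem_biUnion (Finset.mem_coe.2 (Finset.mem_range.2 hj)) hY)
        · refine Or.inr (Set.mem_iUnion.2 ⟨j - (k + 1), ?_⟩)
          rwa [show n + k + 1 + 1 + (j - (k + 1)) = n + 1 + j by omega]
      refine (measureReal_mono hsub).trans ((measureReal_union_le _ _).trans ?_)
      gcongr
      have := measure_iUnion_le_half_pow (S := fun j => clopenSection u p X (n + k + 1 + 1 + j))
        (a := n + k + 1) fun j => hμ X _
      have := ENNReal.toReal_mono (by finiteness) this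
      refine this.trans ?_
      simp only [one_div, ENNReal.toReal_pow, ENNReal.toReal_inv, ENNReal.toReal_ofNat]
      exact pow_le_pow_of_le_one (by norm_num) (by norm_num) (by omega)

theorem not_schnorrRandomUniformlyRel_of_frequently {A B : Cantor} (hu : Computable u)
    (hp : Computable fun x : ℕ × List Bool × List Bool => p x.1 x.2.1 x.2.2)
    (hμ : ∀ X m, coinMeasure (clopenSection u p X m) ≤ (1 / 2) ^ m)
    (h : ∃ᶠ m in atTop, B ∈ clopenSection u p A m) : ¬ SchnorrRandomUniformlyRel B A := by
  refine not_not.2 ⟨_, isUniformSchnorrTest_tail hu hp hμ, Set.mem_iInter.2 fun n => ?_⟩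
  obtain ⟨m, hm, hB⟩ := frequently_atTop.1 h (n + 1)
  refine Set.mem_iUnion.2 ⟨m - (n + 1), ?_⟩
  rwa [show n + 1 + (m - (n + 1)) = m by omega]

end BorelCantelli

/-! ### Uniform tests at computable oracles -/

/-- Search for an initial segment of `X` long enough for the procedure to answer; any answer it
gives is correct. -/
theorem TotalComputable.computable_apply {Φ : Cantor → ℕ → ℕ} (hΦ : TotalComputable Φ)
    {X : ℕ → Bool} (hX : Computable X) : Computable (Φ X) := by
  obtain ⟨φ, hφ, h⟩ := hΦ
  replace hφ : Computable fun x : List Bool × ℕ => φ x.1 x.2 := hφ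
  obtain ⟨k, hk, hks⟩ := Computable.exists_search
    (p := fun n k => (φ (initSeg X k) n).isSome) (by fun_prop) fun n => by
      obtain ⟨k, hk⟩ := (h X n).1
      exact ⟨k, by simp [hk]⟩
  refine (show Computable fun n => (φ (initSeg X (k n)) n).getD 0 by fun_prop).of_eq fun n => ?_
  obtain ⟨m, hm⟩ := Option.isSome_iff_exists.1 (hks n)
  rw [hm, Option.getD_some, (h X n).2 _ _ hm]

theorem IsUniformSchnorrTest.isSchnorrTest {U : Cantor → ℕ → Set Cantor}
    (hU : IsUniformSchnorrTest U) {X : ℕ → Bool} (hX : Computable X) : IsSchnorrTest (U X) := by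
  obtain ⟨Φ, hΦ, hE⟩ := hU
  have hc : Computable (Φ X) := hΦ.computable_apply hX
  refine ⟨⟨⟨fun n s => Φ X (2 * Nat.pair n s),
    show Computable fun x : ℕ × ℕ => Φ X (2 * Nat.pair x.1 x.2) by fun_prop, (hE X).open_eq⟩,
    (hE X).measure_le⟩, fun n s => Φ X (2 * Nat.pair n s + 1),
    show Computable fun x : ℕ × ℕ => Φ X (2 * Nat.pair x.1 x.2 + 1) by fun_prop,
    (hE X).measure_code⟩

/-- The Borel–Cantelli criterion: a sequence that lies in infinitely many sets of a computable
sequence of clopen sets of measure at most `2⁻ᵐ` is not Schnorr random. -/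
theorem not_schnorrRandom_of_frequently {u : ℕ → ℕ} {p : ℕ → List Bool → Bool} {A : Cantor}
    (hu : Computable u) (hp : Computable fun x : ℕ × List Bool => p x.1 x.2)
    (hμ : ∀ m, coinMeasure {X | p m (initSeg X (u m)) = true} ≤ (1 / 2) ^ m)
    (h : ∃ᶠ m in atTop, p m (initSeg A (u m)) = true) : ¬ SchnorrRandom A := by
  -- The family ignores its oracle, so the uniform test may be evaluated at the computable zero
  -- sequence.
  have hU := isUniformSchnorrTest_tail (p := fun m _ σ => p m σ) hu (by fun_prop) fun _ => hμ
  refine not_not.2 ⟨_, hU.isSchnorrTest (X := fun _ => false) (by fun_prop),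
    Set.mem_iInter.2 fun n => ?_⟩
  obtain ⟨m, hm, hA⟩ := frequently_atTop.1 h (n + 1)
  refine Set.mem_iUnion.2 ⟨m - (n + 1), ?_⟩
  rwa [show n + 1 + (m - (n + 1)) = m by omega]

/-! ### Finite stages of a Schnorr test -/

/-- The string with code `c`, if there is one. -/
def strOfCode (c : ℕ) : Option (List Bool) :=
  (Encodable.decode (α := Option (List Bool)) c).join

/-- The length of the string with code `c`. -/
def codeUse (c : ℕ) : ℕ := (strOfCode c).elim 0 List.length

/-- Decides whether a string extends the string with code `c`. -/
def codeTest (c : ℕ) (σ : List Bool) : Bool :=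
  (strOfCode c).elim false fun τ => decide (σ.take τ.length = τ)

/-- Decides whether a string extends one of the first `s` strings coded by `c`. -/
def stageTest (c : ℕ → ℕ) (s : ℕ) (σ : List Bool) : Bool :=
  (List.range s).any fun t => codeTest (c t) σ

/-- A bound for the lengths of the first `s` strings coded by `c`. -/
def stageUse (c : ℕ → ℕ) (s : ℕ) : ℕ := ∑ t ∈ Finset.range s, codeUse (c t)

/-- The union of the first `s` basic open sets coded by `c`. -/
def stage (c : ℕ → ℕ) (s : ℕ) : Set Cantor := ⋃ t ∈ Finset.range s, basicOpenOfCode (c t)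

section

variable {α : Type*} [Primcodable α] {f : α → ℕ} {g : α → List Bool} {c : α → ℕ → ℕ}

@[fun_prop]
theorem computable_strOfCode (hf : Computable f) : Computable fun a => strOfCode (f a) := by
  unfold strOfCode
  fun_prop

@[fun_prop]
theorem computable_codeUse (hf : Computable f) : Computable fun a => codeUse (f a) := by
  unfold codeUse
  fun_prop

@[fun_prop]
theorem computable_codeTest (hf : Computable f) (hg : Computable g) :
    Computable fun a => codeTest (f a) (g a) := by
  unfold codeTest
  fun_prop

@[fun_prop]
theorem computable_stageTest (hc : Computable fun x : α × ℕ => c x.1 x.2) (hf : Computable f)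
    (hg : Computable g) : Computable fun a => stageTest (c a) (f a) (g a) := by
  unfold stageTest
  fun_prop

@[fun_prop]
theorem computable_stageUse (hc : Computable fun x : α × ℕ => c x.1 x.2) (hf : Computable f) :
    Computable fun a => stageUse (c a) (f a) := by
  unfold stageUse
  fun_prop

end

theorem codeTest_initSeg {c L : ℕ} (h : codeUse c ≤ L) (X : Cantor) :
    codeTest c (initSeg X L) = true ↔ X ∈ basicOpenOfCode c := by
  have hb : basicOpenOfCode c = basicOpen (strOfCode c) := rfl
  rw [hb]
  unfold codeTest codeUse at *
  cases ho : strOfCode c with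
  | none => simp [basicOpen]
  | some τ =>
    simp only [ho, Option.elim_some] at h
    simp [basicOpen, strCylinder, take_initSeg, min_eq_left h]

theorem stageTest_initSeg {c : ℕ → ℕ} {s L : ℕ} (h : stageUse c s ≤ L) (X : Cantor) :
    stageTest c s (initSeg X L) = true ↔ X ∈ stage c s := by
  simp only [stageTest, List.any_eq_true, List.mem_range, stage, Set.mem_iUnion,
    Finset.mem_range, exists_prop]
  refine exists_congr fun t => and_congr_right fun ht => codeTest_initSeg (le_trans ?_ h) X
  exact Finset.single_le_sum (f := fun t => codeUse (c t)) (fun _ _ => Nat.zero_le _)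
    (Finset.mem_range.2 ht)

theorem stage_mono (c : ℕ → ℕ) : Monotone (stage c) := fun _ _ hst =>
  Set.biUnion_subset_biUnion_left fun _ hj =>
    Finset.mem_range.2 ((Finset.mem_range.1 hj).trans_le hst)

theorem stage_subset (c : ℕ → ℕ) (s : ℕ) : stage c s ⊆ openOfCode c :=
  Set.iUnion₂_subset fun t _ => Set.subset_iUnion (fun t => basicOpenOfCode (c t)) t

theorem iUnion_stage (c : ℕ → ℕ) : ⋃ s, stage c s = openOfCode c := by
  refine Set.Subset.antisymm (Set.iUnion_subset (stage_subset c))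
    (Set.iUnion_subset fun t X hX => ?_)
  exact Set.mem_iUnion.2 ⟨t + 1, Set.mem_biUnion (Finset.mem_coe.2 (by simp)) hX⟩

theorem measurableSet_stage (c : ℕ → ℕ) (s : ℕ) : MeasurableSet (stage c s) := by
  have : stage c s = {X | stageTest c s (initSeg X (stageUse c s)) = true} := by
    ext X
    exact (stageTest_initSeg le_rfl X).symm
  rw [this]
  exact measurableSet_setOf_initSeg (fun σ => stageTest c s σ = true) _

theorem coinMeasure_real_stage (c : ℕ → ℕ) (s : ℕ) :
    coinMeasure.real (stage c s) =
      countStr (stageTest c s) (stageUse c s) / 2 ^ stageUse c s := by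
  rw [← coinMeasure_real_setOf_initSeg]
  congr 1
  ext X
  exact (stageTest_initSeg le_rfl X).symm

theorem IsFastCauchyCode.abs_sub_le {q : ℕ → ℕ} {x : ℝ} (h : IsFastCauchyCode q x) (m : ℕ) :
    |x - ratOfCode (q m)| ≤ (1 / 2) ^ m := by
  refine le_of_tendsto ((h.2.sub_const _).abs) (eventually_atTop.2 ⟨m, fun n hn => ?_⟩)
  have := (Rat.cast_le (K := ℝ)).2 (h.1 m n hn)
  push_cast at this
  exact this

/-- Decides, on codes, whether `r < c / 2 ^ L + 2⁻ᵉ` for the rational number `r` with code `q`. -/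
def approxTest (q c L e : ℕ) : Bool :=
  decide (q.unpair.1.unpair.1 * 2 ^ L * 2 ^ e <
    q.unpair.1.unpair.2 * 2 ^ L * 2 ^ e + c * (q.unpair.2 + 1) * 2 ^ e + (q.unpair.2 + 1) * 2 ^ L)

theorem approxTest_iff (q c L e : ℕ) :
    approxTest q c L e = true ↔ (ratOfCode q : ℝ) < c / 2 ^ L + (1 / 2) ^ e := by
  have h1 : (0 : ℝ) < q.unpair.2 + 1 := by positivity
  have h2 : (0 : ℝ) < 2 ^ L := by positivity
  have h3 : (0 : ℝ) < 2 ^ e := by positivity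
  rw [approxTest, decide_eq_true_iff, ← Nat.cast_lt (α := ℝ)]
  simp only [ratOfCode, one_div, inv_pow]
  push_cast
  rw [div_lt_iff₀ h1, ← sub_pos, ← sub_pos (b := _ - _)]
  have key : ((c : ℝ) / 2 ^ L + (2 ^ e)⁻¹) * (q.unpair.2 + 1) -
      (q.unpair.1.unpair.1 - q.unpair.1.unpair.2) =
      ((q.unpair.1.unpair.2 * 2 ^ L * 2 ^ e + c * (q.unpair.2 + 1) * 2 ^ e +
        (q.unpair.2 + 1) * 2 ^ L) - q.unpair.1.unpair.1 * 2 ^ L * 2 ^ e) / (2 ^ L * 2 ^ e) := by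
    field_simp
    ring
  rw [key, div_pos_iff_of_pos_right (by positivity)]

@[fun_prop]
theorem computable_approxTest {α : Type*} [Primcodable α] {q c L e : α → ℕ} (hq : Computable q)
    (hc : Computable c) (hL : Computable L) (he : Computable e) :
    Computable fun a => approxTest (q a) (c a) (L a) (e a) := by
  unfold approxTest
  fun_prop

/-- Decides whether stage `s` approximates the measure coded by `q` up to about `2⁻ᵉ`. -/
def stageSearchTest (c q : ℕ → ℕ) (e s : ℕ) : Bool :=
  decide (e ≤ s) &&
    approxTest (q (e + 2)) (countStr (stageTest c s) (stageUse c s)) (stageUse c s) (e + 1)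

theorem computable_stageSearchTest {c q : ℕ → ℕ → ℕ}
    (hc : Computable fun x : ℕ × ℕ => c x.1 x.2) (hq : Computable fun x : ℕ × ℕ => q x.1 x.2) :
    Computable fun x : (ℕ × ℕ) × ℕ => stageSearchTest (c x.1.1) (q x.1.1) x.1.2 x.2 := by
  have h1 : Computable fun x : (ℕ × ℕ) × ℕ => stageUse (c x.1.1) x.2 := by fun_prop
  have h2 : Computable fun x : (ℕ × ℕ) × ℕ =>
      countStr (stageTest (c x.1.1) x.2) (stageUse (c x.1.1) x.2) :=
    computable_countStr (by fun_prop) h1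
  have h3 : Computable fun x : (ℕ × ℕ) × ℕ => q x.1.1 (x.1.2 + 2) := by fun_prop
  exact Computable.bool_and (Computable.decide_nat_le (by fun_prop) (by fun_prop))
    (computable_approxTest h3 h2 h1 (by fun_prop))

theorem stageSearchTest_iff (c q : ℕ → ℕ) (e s : ℕ) :
    stageSearchTest c q e s = true ↔
      e ≤ s ∧ (ratOfCode (q (e + 2)) : ℝ) < coinMeasure.real (stage c s) + (1 / 2) ^ (e + 1) := by
  rw [stageSearchTest, Bool.and_eq_true, decide_eq_true_iff, approxTest_iff,
    coinMeasure_real_stage]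

/-- The measures of the stages converge to that of the whole set. A stage within `2 ^ (-(e + 2))` of
it passes, because the rational compared is itself off by at most `2 ^ (-(e + 2))`. -/
theorem exists_stageSearchTest {c q : ℕ → ℕ}
    (h : IsFastCauchyCode q (coinMeasure.real (openOfCode c))) (e : ℕ) :
    ∃ s, stageSearchTest c q e s = true := by
  have ht : Tendsto (fun s => coinMeasure.real (stage c s)) atTop
      (𝓝 (coinMeasure.real (openOfCode c))) := by
    rw [← iUnion_stage]
    exact (ENNReal.tendsto_toReal (measure_ne_top _ _)).comp
      (tendsto_measure_iUnion_atTop (stage_mono c))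
  have hlt : coinMeasure.real (openOfCode c) - (1 / 2) ^ (e + 2) <
      coinMeasure.real (openOfCode c) :=
    sub_lt_self _ (by positivity)
  obtain ⟨s, hs1, hs2⟩ := ((ht.eventually (lt_mem_nhds hlt)).and (eventually_ge_atTop e)).exists
  refine ⟨s, (stageSearchTest_iff _ _ _ _).2 ⟨hs2, ?_⟩⟩
  have h1 := abs_le.1 (h.abs_sub_le (e + 2))
  have h2 : (1 / 2 : ℝ) ^ (e + 1) = 2 * (1 / 2) ^ (e + 2) := by ring
  linarith [h1.1]

/-- The measures of the sets of a Schnorr test can be approximated effectively by stages. -/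
theorem IsSchnorrTest.exists_stage {U : ℕ → Set Cantor} (hT : IsSchnorrTest U) :
    ∃ (c : ℕ → ℕ → ℕ) (s : ℕ × ℕ → ℕ), (Computable fun x : ℕ × ℕ => c x.1 x.2) ∧ Computable s ∧
      (∀ n, U n = openOfCode (c n)) ∧ (∀ n e, e ≤ s (n, e)) ∧
      ∀ n e, coinMeasure.real (U n \ stage (c n) (s (n, e))) ≤ (1 / 2) ^ e := by
  obtain ⟨⟨⟨c, hc, hU⟩, -⟩, q, hq, hqU⟩ := hT
  obtain ⟨s, hs, hsp⟩ := Computable.exists_search (α := ℕ × ℕ)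
    (p := fun x s => stageSearchTest (c x.1) (q x.1) x.2 s) (computable_stageSearchTest hc hq)
    fun x => exists_stageSearchTest (hU x.1 ▸ hqU x.1) x.2
  refine ⟨c, s, hc, hs, hU, fun n e => ((stageSearchTest_iff _ _ _ _).1 (hsp (n, e))).1,
    fun n e => ?_⟩
  have h := ((stageSearchTest_iff _ _ _ _).1 (hsp (n, e))).2
  have h1 := abs_le.1 ((hqU n).abs_sub_le (e + 2))
  have h2 : (1 / 2 : ℝ) ^ (e + 1) = 2 * (1 / 2) ^ (e + 2) := by ring
  have h3 : (1 / 2 : ℝ) ^ e = 4 * (1 / 2) ^ (e + 2) := by ring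
  have h4 : (0 : ℝ) < (1 / 2) ^ (e + 2) := by positivity
  -- The approximation error and the slack of the search add up to `3 * 2 ^ (-(e + 2))`, below
  -- `2⁻ᵉ`.
  rw [measureReal_sdiff (hU n ▸ stage_subset _ _) (measurableSet_stage _ _)]
  dsimp only at h h1
  linarith [h1.2]

/-- A sequence that is not Schnorr random lies in infinitely many sets of a computable sequence
of clopen sets of measure at most `4⁻ᵐ`. -/
theorem exists_clopen_of_not_schnorrRandom {A : Cantor} (hA : ¬ SchnorrRandom A) :
    ∃ (u : ℕ → ℕ) (p : ℕ → List Bool → Bool), Computable u ∧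
      (Computable fun x : ℕ × List Bool => p x.1 x.2) ∧
      (∀ m, coinMeasure {X | p m (initSeg X (u m)) = true} ≤ (1 / 2) ^ (2 * m)) ∧
      ∃ᶠ m in atTop, p m (initSeg A (u m)) = true := by
  obtain ⟨U, hT, hAU⟩ := not_not.1 hA
  have hμ := hT.1.2
  obtain ⟨c, s, hc, hs, hU, hsle, hsμ⟩ := hT.exists_stage
  -- The clopen set with index `⟨n, k⟩` is what stage `S n (k + 1)` of `U (N n)` adds to stage `S n
  -- k`. It lies in `U (N n)` minus stage `S n k`. For `k = 0` that stage is empty, and the choice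
  -- of `N n` makes the bound of the test itself suffice.
  let N : ℕ → ℕ := fun n => 2 * Nat.pair n 0
  let S : ℕ → ℕ → ℕ := fun n k => bif decide (k = 0) then 0 else s (N n, 2 * Nat.pair n k)
  have hSc : Computable fun x : ℕ × ℕ => S x.1 x.2 := by
    simp only [S, N]
    fun_prop
  have hNc : Computable N := by
    simp only [N]
    fun_prop
  have hSμ : ∀ n k, coinMeasure.real (U (N n) \ stage (c (N n)) (S n k)) ≤
      (1 / 2) ^ (2 * Nat.pair n k) := by
    intro n k
    by_cases hk : k = 0
    · subst hk
      simp only [S, decide_true, cond_true, stage, Finset.range_zero]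
      have := ENNReal.toReal_mono (by finiteness) (hμ (N n))
      simpa [N, measureReal_def] using this
    · simp only [S, hk, decide_false, cond_false]
      exact hsμ _ _
  let u : ℕ → ℕ := fun m => stageUse (c (N m.unpair.1)) (S m.unpair.1 m.unpair.2) +
    stageUse (c (N m.unpair.1)) (S m.unpair.1 (m.unpair.2 + 1))
  let p : ℕ → List Bool → Bool := fun m σ =>
    stageTest (c (N m.unpair.1)) (S m.unpair.1 (m.unpair.2 + 1)) σ &&
      !stageTest (c (N m.unpair.1)) (S m.unpair.1 m.unpair.2) σ
  have hp : ∀ m X, p m (initSeg X (u m)) = true ↔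
      X ∈ stage (c (N m.unpair.1)) (S m.unpair.1 (m.unpair.2 + 1)) \
        stage (c (N m.unpair.1)) (S m.unpair.1 m.unpair.2) := by
    intro m X
    rw [Set.mem_sdiff, ← stageTest_initSeg (L := u m) (by simp [u]),
      ← stageTest_initSeg (L := u m) (by simp [u])]
    simp [p]
  refine ⟨u, p, by simp only [u]; fun_prop, by simp only [p]; fun_prop, fun m => ?_, ?_⟩
  · have h := hSμ m.unpair.1 m.unpair.2
    rw [Nat.pair_unpair] at h
    have h' : coinMeasure.real {X | p m (initSeg X (u m)) = true} ≤ (1 / 2) ^ (2 * m) := by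
      refine le_trans (measureReal_mono ?_) h
      intro X hX
      have := (hp m X).1 hX
      exact ⟨hU (N m.unpair.1) ▸ stage_subset _ _ this.1, this.2⟩
    rw [← ENNReal.toReal_le_toReal (measure_ne_top _ _) (by finiteness)]
    simpa [measureReal_def] using h'
  · refine frequently_atTop.2 fun n => ?_
    have hAn : A ∈ U (N n) := Set.mem_iInter.1 hAU _
    -- The stages `S n k` are unbounded in `k`, because the search for precision `e` returns a stage
    -- at least `e`.
    have hex : ∃ k, A ∈ stage (c (N n)) (S n k) := by
      rw [hU (N n), ← iUnion_stage] at hAn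
      obtain ⟨t, ht⟩ := Set.mem_iUnion.1 hAn
      refine ⟨t + 1, stage_mono _ ?_ ht⟩
      have h1 := hsle (N n) (2 * Nat.pair n (t + 1))
      have h2 := Nat.right_le_pair n (t + 1)
      simp only [S, Nat.add_eq_zero_iff, one_ne_zero, and_false, decide_false, cond_false]
      omega
    classical
    have hspec := Nat.find_spec hex
    obtain ⟨k, hk⟩ : ∃ k, Nat.find hex = k + 1 := by
      refine Nat.exists_eq_succ_of_ne_zero fun h0 => ?_
      rw [h0] at hspec
      simp [S, stage] at hspec
    have hmin := Nat.find_min hex (m := k) (by omega)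
    -- `A` first appears at `S n (k + 1)`, hence lies in the difference with index `⟨n, k⟩`. This
    -- index is at least `n`, so such indices are unbounded.
    refine ⟨Nat.pair n k, Nat.left_le_pair n k, (hp _ _).2 ?_⟩
    rw [hk] at hspec
    simpa using ⟨hspec, hmin⟩

/-! ### Sections of the join and Fubini's theorem -/

theorem cantorJoin_initSeg_congr (X Y : Cantor) (u : ℕ) :
    initSeg (cantorJoin (extend (initSeg X u)) (extend (initSeg Y u))) u =
      initSeg (cantorJoin X Y) u := by
  refine initSeg_congr.2 fun i hi => ?_
  have h : i / 2 < u := by omega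
  simp only [cantorJoin, extend_initSeg _ h]

theorem initSeg_evenPart_extend (Z : Cantor) {k l : ℕ} (h : 2 * l ≤ k) :
    initSeg (evenPart (extend (initSeg Z k))) l = initSeg (evenPart Z) l :=
  initSeg_congr.2 fun i hi => extend_initSeg _ (by omega)

theorem initSeg_oddPart_extend (Z : Cantor) {k l : ℕ} (h : 2 * l ≤ k) :
    initSeg (oddPart (extend (initSeg Z k))) l = initSeg (oddPart Z) l :=
  initSeg_congr.2 fun i hi => extend_initSeg _ (by omega)

section

variable {α : Type*} [Primcodable α] {X Y : α → ℕ → Bool} {k : α → ℕ}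

@[fun_prop]
theorem computable_cantorJoin (hX : Computable fun x : α × ℕ => X x.1 x.2)
    (hY : Computable fun x : α × ℕ => Y x.1 x.2) (hk : Computable k) :
    Computable fun a => cantorJoin (X a) (Y a) (k a) :=
  (show Computable fun a => bif decide (k a % 2 = 0) then X a (k a / 2) else Y a (k a / 2) by
    fun_prop).of_eq fun a => by
      by_cases h : k a % 2 = 0 <;> simp [cantorJoin, h]

@[fun_prop]
theorem computable_evenPart (hX : Computable fun x : α × ℕ => X x.1 x.2) (hk : Computable k) :
    Computable fun a => evenPart (X a) (k a) := by
  unfold evenPart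
  fun_prop

@[fun_prop]
theorem computable_oddPart (hX : Computable fun x : α × ℕ => X x.1 x.2) (hk : Computable k) :
    Computable fun a => oddPart (X a) (k a) := by
  unfold oddPart
  fun_prop

end

theorem measurable_measure_cantorJoin {V : Set Cantor} (hV : MeasurableSet V) :
    Measurable fun X => coinMeasure {Y | cantorJoin X Y ∈ V} :=
  measurable_measure_prodMk_left (measurable_cantorJoin hV)

/-- Fubini's theorem, transported along the measure-preserving join. -/
theorem lintegral_measure_cantorJoin {V : Set Cantor} (hV : MeasurableSet V) :
    ∫⁻ X, coinMeasure {Y | cantorJoin X Y ∈ V} ∂coinMeasure = coinMeasure V := by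
  rw [← measurePreserving_cantorJoin.measure_preimage hV.nullMeasurableSet,
    Measure.prod_apply (measurable_cantorJoin hV)]
  rfl

/-- The section over `X` is the whole space if `X ∈ S` and empty otherwise. -/
theorem coinMeasure_evenPart_preimage {S : Set Cantor} (hS : MeasurableSet S) :
    coinMeasure (evenPart ⁻¹' S) = coinMeasure S := by
  have hm : Measurable evenPart := measurable_pi_lambda _ fun n => measurable_pi_apply _
  rw [← lintegral_measure_cantorJoin (hm hS), ← lintegral_indicator_one hS]
  refine lintegral_congr fun X => ?_
  by_cases hX : X ∈ S <;> simp [hX]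

theorem not_schnorrRandom_cantorJoin_of_left {A B : Cantor} (hA : ¬ SchnorrRandom A) :
    ¬ SchnorrRandom (cantorJoin A B) := by
  obtain ⟨u, p, hu, hp, hμ, h⟩ := exists_clopen_of_not_schnorrRandom hA
  have key : ∀ m Z, initSeg (evenPart (extend (initSeg Z (2 * u m)))) (u m) =
      initSeg (evenPart Z) (u m) := fun m Z => initSeg_evenPart_extend Z le_rfl
  refine not_schnorrRandom_of_frequently (u := fun m => 2 * u m)
    (p := fun m σ => p m (initSeg (evenPart (extend σ)) (u m))) (by fun_prop) (by fun_prop)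
    (fun m => ?_) ?_
  · simp only [key]
    refine (coinMeasure_evenPart_preimage
      (measurableSet_setOf_initSeg (fun σ => p m σ = true) (u m))).trans_le ((hμ m).trans ?_)
    exact pow_le_pow_right_of_le_one' (by norm_num) (by omega)
  · simpa only [key, evenPart_cantorJoin] using h

/-! ### Trimming the large sections -/

/-- The clopen set described by `p`, read as a family of sections. -/
def joinTest (u : ℕ → ℕ) (p : ℕ → List Bool → Bool) (m : ℕ) (σ τ : List Bool) : Bool :=
  p m (initSeg (cantorJoin (extend σ) (extend τ)) (u m))

/-- Decides whether the section of `joinTest` at a string has measure greater than `2⁻ᵐ`. -/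
def largeSectionTest (u : ℕ → ℕ) (p : ℕ → List Bool → Bool) (m : ℕ) (σ : List Bool) : Bool :=
  decide (2 ^ u m < countStr (joinTest u p m σ) (u m) * 2 ^ m)

section

variable {u : ℕ → ℕ} {p : ℕ → List Bool → Bool}

theorem computable_joinTest (hu : Computable u)
    (hp : Computable fun x : ℕ × List Bool => p x.1 x.2) :
    Computable fun x : ℕ × List Bool × List Bool => joinTest u p x.1 x.2.1 x.2.2 := by
  unfold joinTest
  fun_prop

theorem computable_largeSectionTest (hu : Computable u)
    (hp : Computable fun x : ℕ × List Bool => p x.1 x.2) :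
    Computable fun x : ℕ × List Bool => largeSectionTest u p x.1 x.2 := by
  have hj := computable_joinTest hu hp
  have hc : Computable fun x : ℕ × List Bool => countStr (joinTest u p x.1 x.2) (u x.1) := by
    fun_prop
  exact Computable.decide_nat_lt (by fun_prop) (by fun_prop)

theorem clopenSection_joinTest (X : Cantor) (m : ℕ) :
    clopenSection u (joinTest u p) X m =
      {Y | cantorJoin X Y ∈ {Z | p m (initSeg Z (u m)) = true}} := by
  ext Y
  simp only [clopenSection, joinTest, cantorJoin_initSeg_congr, Set.mem_ofPred_eq]

/-- The section has measure a count over `2 ^ u m`, so the comparison is an exact one between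
natural numbers. This is what makes the trimming computable. -/
theorem largeSectionTest_iff (X : Cantor) (m : ℕ) :
    largeSectionTest u p m (initSeg X (u m)) = true ↔
      (1 / 2) ^ m < coinMeasure (clopenSection u (joinTest u p) X m) := by
  have h : coinMeasure.real (clopenSection u (joinTest u p) X m) =
      countStr (joinTest u p m (initSeg X (u m))) (u m) / 2 ^ u m :=
    coinMeasure_real_setOf_initSeg (joinTest u p m (initSeg X (u m))) (u m)
  rw [← ENNReal.toReal_lt_toReal (by finiteness) (measure_ne_top _ _), ← measureReal_def, h,
    lt_div_iff₀ (by positivity), largeSectionTest, decide_eq_true_iff, ← Nat.cast_lt (α := ℝ)]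
  have : (0 : ℝ) < 2 ^ m := by positivity
  simp only [one_div, ENNReal.toReal_pow, ENNReal.toReal_inv, ENNReal.toReal_ofNat, inv_pow]
  push_cast
  rw [inv_mul_lt_iff₀ this, mul_comm]

/-- Markov's inequality: the measures of the sections integrate to at most `4⁻ᵐ`, and the threshold
is `2⁻ᵐ`. -/
theorem measure_largeSectionTest_le
    (hμ : ∀ m, coinMeasure {Z | p m (initSeg Z (u m)) = true} ≤ (1 / 2) ^ (2 * m)) (m : ℕ) :
    coinMeasure {X | largeSectionTest u p m (initSeg X (u m)) = true} ≤ (1 / 2) ^ m := by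
  have hV := measurableSet_setOf_initSeg (fun σ => p m σ = true) (u m)
  have h1 := mul_meas_ge_le_lintegral (μ := coinMeasure) (measurable_measure_cantorJoin hV)
    ((1 / 2) ^ m)
  rw [lintegral_measure_cantorJoin hV] at h1
  have h2 : (1 / 2) ^ m * coinMeasure {X | largeSectionTest u p m (initSeg X (u m)) = true} ≤
      (1 / 2) ^ m * (1 / 2) ^ m := by
    rw [← pow_add, ← two_mul]
    refine (mul_le_mul_right (measure_mono fun X hX => ?_) _).trans (h1.trans (hμ m))
    have := (largeSectionTest_iff X m).1 hX
    rw [clopenSection_joinTest] at this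
    exact this.le
  exact (ENNReal.mul_le_mul_iff_right (pow_ne_zero _ (by norm_num)) (by finiteness)).1 h2

end

/-- Emptying the large sections bounds the measures for all oracles. Schnorr randomness of `A`
ensures that only finitely many sections over `A` are emptied. -/
theorem not_schnorrRandomUniformlyRel_of_cantorJoin {A B : Cantor}
    (h : ¬ SchnorrRandom (cantorJoin A B)) (hA : SchnorrRandom A) :
    ¬ SchnorrRandomUniformlyRel B A := by
  obtain ⟨u, p, hu, hp, hμ, hAB⟩ := exists_clopen_of_not_schnorrRandom h
  have hj := computable_joinTest hu hp
  have hl := computable_largeSectionTest hu hp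
  have hfin : ∀ᶠ m in atTop, ¬ largeSectionTest u p m (initSeg A (u m)) = true := by
    by_contra hcon
    exact not_schnorrRandom_of_frequently hu hl (measure_largeSectionTest_le hμ) hcon hA
  refine not_schnorrRandomUniformlyRel_of_frequently (u := u)
    (p := fun m σ τ => !largeSectionTest u p m σ && joinTest u p m σ τ) hu (by fun_prop)
    (fun X m => ?_) ((hAB.and_eventually hfin).mono fun m hm => ?_)
  · by_cases hX : largeSectionTest u p m (initSeg X (u m)) = true
    · simp [clopenSection, hX]
    · refine le_trans (measure_mono fun Y hY => ?_) (not_lt.1 (mt (largeSectionTest_iff X m).2 hX))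
      simp only [clopenSection, Set.mem_ofPred_eq, Bool.and_eq_true] at hY
      exact hY.2
  · have h1 : B ∈ clopenSection u (joinTest u p) A m := by
      rw [clopenSection_joinTest]
      exact hm.1
    have h2 := hm.2
    simp only [clopenSection, Set.mem_ofPred_eq] at h1 ⊢
    simp [h1, h2]

/-! ### Compactness and the use of total computable maps -/

/-- The sequences answered on a segment shorter than `L` form an open set that grows with `L`; these
sets cover the compact Cantor space, so one of them is everything. -/
theorem exists_uniform_use {φ : List Bool → Option ℕ}
    (h : ∀ X : Cantor, ∃ k, (φ (initSeg X k)).isSome = true) :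
    ∃ L, ∀ X : Cantor, ∃ k < L, (φ (initSeg X k)).isSome = true := by
  obtain ⟨L, hL⟩ := isCompact_univ.elim_directed_cover
    (fun L : ℕ => ⋃ k ∈ Set.Iio L, {X : Cantor | (φ (initSeg X k)).isSome = true})
    (fun L => isOpen_biUnion fun k _ => isOpen_setOf_initSeg (fun σ => (φ σ).isSome = true) k)
    (fun X _ => by
      obtain ⟨k, hk⟩ := h X
      exact Set.mem_iUnion.2 ⟨k + 1, Set.mem_biUnion (Set.mem_Iio.2 (Nat.lt_succ_self k)) hk⟩)
    (Monotone.directed_le fun L M hLM => Set.biUnion_subset_biUnion_left (Set.Iio_subset_Iio hLM))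
  refine ⟨L, fun X => ?_⟩
  simpa using hL (Set.mem_univ X)

/-- The value that `φ` returns on the first initial segment, shorter than `k`, of a string on
which it returns a value. -/
def firstValue (φ : List Bool → Option ℕ) (k : ℕ) (σ : List Bool) : Option ℕ :=
  Nat.rec none (fun j o => o.elim (φ (σ.take j)) some) k

theorem exists_of_firstValue_eq_some {φ : List Bool → Option ℕ} {k : ℕ} {σ : List Bool} {m : ℕ}
    (h : firstValue φ k σ = some m) : ∃ j < k, φ (σ.take j) = some m := by
  induction k with
  | zero => simp [firstValue] at h
  | succ k ih =>
    have hs : firstValue φ (k + 1) σ = (firstValue φ k σ).elim (φ (σ.take k)) some := rfl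
    rw [hs] at h
    cases ho : firstValue φ k σ with
    | none =>
      rw [ho] at h
      exact ⟨k, Nat.lt_succ_self k, h⟩
    | some m' =>
      rw [ho] at h
      obtain ⟨j, hj, hm⟩ := ih (ho.trans h)
      exact ⟨j, hj.trans (Nat.lt_succ_self k), hm⟩

theorem isSome_firstValue {φ : List Bool → Option ℕ} {k : ℕ} {σ : List Bool}
    (h : ∃ j < k, (φ (σ.take j)).isSome = true) : (firstValue φ k σ).isSome = true := by
  induction k with
  | zero => simp at h
  | succ k ih =>
    have hs : firstValue φ (k + 1) σ = (firstValue φ k σ).elim (φ (σ.take k)) some := rfl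
    rw [hs]
    cases ho : firstValue φ k σ with
    | some m => rfl
    | none =>
      obtain ⟨j, hj, hm⟩ := h
      rcases Nat.lt_succ_iff_lt_or_eq.1 hj with hj | rfl
      · simpa [ho] using ih ⟨j, hj, hm⟩
      · exact hm

/-- By compactness, the use of a total computable map has a computable bound. -/
theorem TotalComputable.exists_use {Φ : Cantor → ℕ → ℕ} (hΦ : TotalComputable Φ) :
    ∃ (v : ℕ → ℕ) (ψ : ℕ → List Bool → ℕ), Computable v ∧
      (Computable fun x : ℕ × List Bool => ψ x.1 x.2) ∧
      ∀ X i, Φ X i = ψ i (initSeg X (v i)) := by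
  obtain ⟨φ, hφ, h⟩ := hΦ
  replace hφ : Computable fun x : List Bool × ℕ => φ x.1 x.2 := hφ
  -- Whether `L` bounds the use is decidable, since only the `2 ^ L` strings of length `L` need
  -- checking; compactness makes the search succeed.
  obtain ⟨v, hv, hvs⟩ := Computable.exists_search (α := ℕ)
    (p := fun i L => (List.range (2 ^ L)).all fun b => (List.range L).any fun j =>
      (φ ((bitStr L b).take j) i).isSome) (by fun_prop) (fun i => by
      obtain ⟨L, hL⟩ := exists_uniform_use (φ := fun σ => φ σ i) fun X => by
        obtain ⟨k, hk⟩ := (h X i).1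
        exact ⟨k, by simp [hk]⟩
      refine ⟨L, ?_⟩
      simp only [List.all_eq_true, List.any_eq_true, List.mem_range]
      intro b _
      obtain ⟨j, hj, hs⟩ := hL b.testBit
      exact ⟨j, hj, by rwa [bitStr, take_initSeg, min_eq_left hj.le]⟩)
  refine ⟨v, fun i σ => (firstValue (fun σ => φ σ i) (v i) σ).getD 0, hv, ?_, fun X i => ?_⟩
  · unfold firstValue
    fun_prop
  · have hs : (firstValue (fun σ => φ σ i) (v i) (initSeg X (v i))).isSome = true := by
      refine isSome_firstValue ?_
      obtain ⟨b, hb, hbX⟩ := exists_bitStr_eq X (v i)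
      have := hvs i
      simp only [List.all_eq_true, List.any_eq_true, List.mem_range] at this
      rw [← hbX]
      exact this b hb
    obtain ⟨m, hm⟩ := Option.isSome_iff_exists.1 hs
    obtain ⟨j, hj, hjm⟩ := exists_of_firstValue_eq_some hm
    rw [take_initSeg] at hjm
    beta_reduce
    rw [hm, Option.getD_some, (h X i).2 _ _ hjm]

/-! ### Computable means of coded rationals -/

/-- A code of the sum of two rational numbers. -/
def addCode (c d : ℕ) : ℕ :=
  Nat.pair (Nat.pair
    (c.unpair.1.unpair.1 * (d.unpair.2 + 1) + d.unpair.1.unpair.1 * (c.unpair.2 + 1))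
    (c.unpair.1.unpair.2 * (d.unpair.2 + 1) + d.unpair.1.unpair.2 * (c.unpair.2 + 1)))
    ((c.unpair.2 + 1) * (d.unpair.2 + 1) - 1)

theorem ratOfCode_addCode (c d : ℕ) : ratOfCode (addCode c d) = ratOfCode c + ratOfCode d := by
  have h1 : (0 : ℚ) < c.unpair.2 + 1 := by positivity
  have h2 : (0 : ℚ) < d.unpair.2 + 1 := by positivity
  have h3 : (((c.unpair.2 + 1) * (d.unpair.2 + 1) - 1 : ℕ) : ℚ) + 1 =
      (c.unpair.2 + 1) * (d.unpair.2 + 1) := by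
    rw [Nat.cast_sub (Nat.one_le_iff_ne_zero.2 (by positivity))]
    push_cast
    ring
  simp only [ratOfCode, addCode, Nat.unpair_pair, h3]
  push_cast
  field_simp
  ring

/-- A code of the mean of the rational numbers coded by `g` on the strings of length `L`. -/
def meanCode (g : List Bool → ℕ) (L : ℕ) : ℕ :=
  let c : ℕ := Nat.rec 0 (fun i y => addCode y (g (bitStr L i))) (2 ^ L)
  Nat.pair c.unpair.1 ((c.unpair.2 + 1) * 2 ^ L - 1)

theorem ratOfCode_meanCode (g : List Bool → ℕ) (L : ℕ) :
    ratOfCode (meanCode g L) =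
      (∑ i ∈ Finset.range (2 ^ L), ratOfCode (g (bitStr L i))) / 2 ^ L := by
  have h : ∀ n, ratOfCode (Nat.rec 0 (fun i y => addCode y (g (bitStr L i))) n) =
      ∑ i ∈ Finset.range n, ratOfCode (g (bitStr L i)) := by
    intro n
    induction n with
    -- The number `0`, from which the recursion starts, codes the rational `0`.
    | zero => simp [ratOfCode]
    | succ n ih => rw [Finset.sum_range_succ, ← ih, ratOfCode_addCode]
  rw [← h]
  simp only [meanCode]
  generalize (Nat.rec 0 (fun i y => addCode y (g (bitStr L i))) (2 ^ L) : ℕ) = c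
  have h3 : (((c.unpair.2 + 1) * 2 ^ L - 1 : ℕ) : ℚ) + 1 = (c.unpair.2 + 1) * 2 ^ L := by
    rw [Nat.cast_sub (Nat.one_le_iff_ne_zero.2 (by positivity))]
    push_cast
    ring
  simp only [ratOfCode, Nat.unpair_pair, h3, div_div]

section

variable {α : Type*} [Primcodable α]

@[fun_prop]
theorem computable_addCode {f g : α → ℕ} (hf : Computable f) (hg : Computable g) :
    Computable fun a => addCode (f a) (g a) := by
  unfold addCode
  fun_prop

theorem computable_meanCode {g : α → List Bool → ℕ} {L : α → ℕ}
    (hg : Computable fun x : α × List Bool => g x.1 x.2) (hL : Computable L) :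
    Computable fun a => meanCode (g a) (L a) := by
  have hc : Computable fun a =>
      (Nat.rec 0 (fun i y => addCode y (g a (bitStr (L a) i))) (2 ^ L a) : ℕ) :=
    Computable.nat_rec_fun (h := fun a i y => addCode y (g a (bitStr (L a) i)))
      (by fun_prop) (by fun_prop) (by fun_prop)
  unfold meanCode
  fun_prop

end

theorem ratOfCode_meanCode_eq_integral (g : List Bool → ℕ) (L : ℕ) :
    (ratOfCode (meanCode g L) : ℝ) = ∫ X, (ratOfCode (g (initSeg X L)) : ℝ) ∂coinMeasure := by
  rw [integral_comp_initSeg (fun σ => (ratOfCode (g σ) : ℝ)), ratOfCode_meanCode]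
  push_cast
  rfl

/-! ### The join of a uniform Schnorr test -/

section JoinedTest

variable (v : ℕ → ℕ) (ψ : ℕ → List Bool → ℕ)

/-- Decides whether the cylinder of `ρ` is listed in the join of the open sets coded by `ψ i`. -/
def joinedOpenTest (i : ℕ) (ρ : List Bool) : Bool :=
  decide (v i + codeUse (ψ i (initSeg (evenPart (extend ρ)) (v i))) < ρ.length / 2) &&
    codeTest (ψ i (initSeg (evenPart (extend ρ)) (v i)))
      (initSeg (oddPart (extend ρ)) (ρ.length / 2))

/-- The code of the basic open set at position `s` in the list for the join of the `n`-th sets. -/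
def joinedOpenCode (n s : ℕ) : ℕ :=
  bif joinedOpenTest v ψ (2 * Nat.pair n s.unpair.1) ((Encodable.decode s.unpair.2).getD [])
    then Encodable.encode (some ((Encodable.decode s.unpair.2 : Option (List Bool)).getD []))
    else Encodable.encode (none : Option (List Bool))

variable {v ψ}

theorem computable_joinedOpenTest (hv : Computable v)
    (hψ : Computable fun x : ℕ × List Bool => ψ x.1 x.2) :
    Computable fun x : ℕ × List Bool => joinedOpenTest v ψ x.1 x.2 := by
  have h : Computable fun x : ℕ × List Bool =>
      ψ x.1 (initSeg (evenPart (extend x.2)) (v x.1)) := by fun_prop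
  exact Computable.bool_and (Computable.decide_nat_lt (by fun_prop) (by fun_prop)) (by fun_prop)

theorem computable_joinedOpenCode (hv : Computable v)
    (hψ : Computable fun x : ℕ × List Bool => ψ x.1 x.2) :
    Computable fun x : ℕ × ℕ => joinedOpenCode v ψ x.1 x.2 := by
  have h := computable_joinedOpenTest hv hψ
  have hd : Computable fun x : ℕ × ℕ =>
      (Encodable.decode x.2.unpair.2 : Option (List Bool)).getD [] := by fun_prop
  unfold joinedOpenCode
  fun_prop

/-- The length condition comes first: once it holds, both halves are long enough that no padded zero
is read. A prefix too short for the use `v i` is rejected whatever its padding gives. -/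
theorem joinedOpenTest_initSeg (i L : ℕ) (Z : Cantor) :
    joinedOpenTest v ψ i (initSeg Z L) = true ↔
      v i + codeUse (ψ i (initSeg (evenPart Z) (v i))) < L / 2 ∧
        oddPart Z ∈ basicOpenOfCode (ψ i (initSeg (evenPart Z) (v i))) := by
  by_cases hvL : v i ≤ L / 2
  · rw [joinedOpenTest, length_initSeg, initSeg_evenPart_extend Z (by omega),
      initSeg_oddPart_extend Z (by omega), Bool.and_eq_true, decide_eq_true_iff]
    refine and_congr_right fun h => codeTest_initSeg (by omega) _
  · have h1 : ∀ k, ¬ v i + k < L / 2 := fun k => by omega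
    simp [joinedOpenTest, h1]

theorem openOfCode_joinedOpenCode (n : ℕ) (Z : Cantor) :
    Z ∈ openOfCode (joinedOpenCode v ψ n) ↔
      oddPart Z ∈ openOfCode fun r =>
        ψ (2 * Nat.pair n r) (initSeg (evenPart Z) (v (2 * Nat.pair n r))) := by
  simp only [openOfCode, Set.mem_iUnion]
  constructor
  · rintro ⟨s, hs⟩
    refine ⟨s.unpair.1, ?_⟩
    unfold joinedOpenCode at hs
    set ρ := (Encodable.decode s.unpair.2 : Option (List Bool)).getD []
    cases hb : joinedOpenTest v ψ (2 * Nat.pair n s.unpair.1) ρ with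
    | false =>
      rw [hb] at hs
      simp [basicOpenOfCode, basicOpen] at hs
    | true =>
      rw [hb] at hs
      simp only [basicOpenOfCode, basicOpen, cond_true, Encodable.encodek, Option.join_some,
        strCylinder, Set.mem_ofPred_eq] at hs
      rw [← hs] at hb
      exact ((joinedOpenTest_initSeg _ _ _).1 hb).2
  · rintro ⟨r, hr⟩
    set i := 2 * Nat.pair n r with hi
    -- Each half of a prefix of this length exceeds the use of the oracle plus the length of the
    -- listed string.
    set L := 2 * (v i + codeUse (ψ i (initSeg (evenPart Z) (v i))) + 1) with hL
    refine ⟨Nat.pair r (Encodable.encode (initSeg Z L)), ?_⟩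
    have hb : joinedOpenTest v ψ i (initSeg Z L) = true :=
      (joinedOpenTest_initSeg _ _ _).2 ⟨by omega, hr⟩
    simp [joinedOpenCode, ← hi, hb, basicOpenOfCode, basicOpen, strCylinder]

end JoinedTest

theorem abs_integral_le_of_abs_le {f : Cantor → ℝ} {C : ℝ} (h : ∀ X, |f X| ≤ C) :
    |∫ X, f X ∂coinMeasure| ≤ C := by
  simpa using norm_integral_le_of_norm_le_const (f := f) (C := C) (μ := coinMeasure) (ae_of_all _ h)

/-- The rational approximations are integrated over the oracle. Their error bounds hold at every
`X`, so they survive integration; bounded use makes each integral a finite mean. -/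
theorem IsUniformSchnorrTest.isSchnorrTest_join {U : Cantor → ℕ → Set Cantor}
    (hU : IsUniformSchnorrTest U) :
    IsSchnorrTest fun n => {Z | oddPart Z ∈ U (evenPart Z) n} := by
  obtain ⟨Φ, hΦ, hE⟩ := hU
  obtain ⟨v, ψ, hv, hψ, hΦψ⟩ := hΦ.exists_use
  have hopen : ∀ n, {Z | oddPart Z ∈ U (evenPart Z) n} = openOfCode (joinedOpenCode v ψ n) := by
    intro n
    ext Z
    rw [openOfCode_joinedOpenCode, Set.mem_ofPred_eq, (hE (evenPart Z)).open_eq n]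
    simp only [hΦψ]
  have hmeas : ∀ n, MeasurableSet {Z | oddPart Z ∈ U (evenPart Z) n} := fun n => by
    rw [hopen n]
    exact (isOpen_openOfCode _).measurableSet
  -- The sections of the joined set are the original test sets, so measurability of the joined set
  -- gives that of their measures in `X`.
  have hsec : ∀ n X, {Y | cantorJoin X Y ∈ {Z | oddPart Z ∈ U (evenPart Z) n}} = U X n := by
    intro n X
    ext Y
    simp
  have hUm : ∀ n, Measurable fun X => coinMeasure (U X n) := fun n => by
    simpa only [hsec] using measurable_measure_cantorJoin (hmeas n)
  have hlint : ∀ n, ∫⁻ X, coinMeasure (U X n) ∂coinMeasure =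
      coinMeasure {Z | oddPart Z ∈ U (evenPart Z) n} := fun n => by
    simpa only [hsec] using lintegral_measure_cantorJoin (hmeas n)
  have hintegral : ∀ n, ∫ X, coinMeasure.real (U X n) ∂coinMeasure =
      coinMeasure.real {Z | oddPart Z ∈ U (evenPart Z) n} := fun n => by
    rw [measureReal_def, ← hlint n]
    exact integral_toReal (hUm n).aemeasurable (ae_of_all _ fun X => measure_lt_top _ _)
  have hUi : ∀ n, Integrable (fun X => coinMeasure.real (U X n)) coinMeasure := fun n =>
    Integrable.of_bound (hUm n).ennreal_toReal.aestronglyMeasurable 1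
      (ae_of_all _ fun X => by
        rw [Real.norm_of_nonneg measureReal_nonneg]
        exact measureReal_le_one)
  refine ⟨⟨⟨joinedOpenCode v ψ, computable_joinedOpenCode hv hψ, hopen⟩, fun n => ?_⟩,
    fun n k => meanCode (ψ (2 * Nat.pair n k + 1)) (v (2 * Nat.pair n k + 1)),
    computable_meanCode (g := fun x : ℕ × ℕ => ψ (2 * Nat.pair x.1 x.2 + 1)) (by fun_prop)
      (by fun_prop), fun n => ?_⟩
  · rw [← hlint n]
    refine (lintegral_mono fun X => (hE X).measure_le n).trans ?_
    simp
  · have hq : ∀ k,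
        (ratOfCode (meanCode (ψ (2 * Nat.pair n k + 1)) (v (2 * Nat.pair n k + 1))) : ℝ) =
        ∫ X, (ratOfCode (Φ X (2 * Nat.pair n k + 1)) : ℝ) ∂coinMeasure := fun k => by
      simp only [hΦψ, ratOfCode_meanCode_eq_integral]
    have hqi : ∀ k, Integrable (fun X => (ratOfCode (Φ X (2 * Nat.pair n k + 1)) : ℝ))
        coinMeasure := fun k => by
      simp only [hΦψ]
      exact integrable_comp_initSeg
        (fun σ => (ratOfCode (ψ (2 * Nat.pair n k + 1) σ) : ℝ)) _
    constructor
    · intro m k hmk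
      rw [← Rat.cast_le (K := ℝ)]
      push_cast
      rw [hq, hq, ← integral_sub (hqi k) (hqi m)]
      refine abs_integral_le_of_abs_le fun X => ?_
      have := (Rat.cast_le (K := ℝ)).2 (((hE X).measure_code n).1 m k hmk)
      push_cast at this
      exact this
    · rw [tendsto_iff_norm_sub_tendsto_zero]
      refine squeeze_zero (fun _ => norm_nonneg _) (fun k => ?_)
        (tendsto_pow_atTop_nhds_zero_of_lt_one (r := (1 / 2 : ℝ)) (by norm_num) (by norm_num))
      beta_reduce
      rw [hq, ← hintegral n, ← integral_sub (hqi k) (hUi n)]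
      refine abs_integral_le_of_abs_le fun X => ?_
      rw [abs_sub_comm]
      exact ((hE X).measure_code n).abs_sub_le k

theorem not_schnorrRandom_cantorJoin_of_right {A B : Cantor}
    (h : ¬ SchnorrRandomUniformlyRel B A) : ¬ SchnorrRandom (cantorJoin A B) := by
  obtain ⟨U, hU, hB⟩ := not_not.1 h
  refine not_not.2 ⟨_, hU.isSchnorrTest_join, Set.mem_iInter.2 fun n => ?_⟩
  simpa using Set.mem_iInter.1 hB n

end SchnorrVL

theorem theorem4p5 (A B : SchnorrVL.Cantor) :
    SchnorrVL.SchnorrRandom (SchnorrVL.cantorJoin A B) ↔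
      SchnorrVL.SchnorrRandom A ∧ SchnorrVL.SchnorrRandomUniformlyRel B A := by
  constructor
  · intro h
    exact ⟨by_contra fun hA => SchnorrVL.not_schnorrRandom_cantorJoin_of_left hA h,
      by_contra fun hB => SchnorrVL.not_schnorrRandom_cantorJoin_of_right hB h⟩
  · rintro ⟨hA, hB⟩
    exact by_contra fun h => SchnorrVL.not_schnorrRandomUniformlyRel_of_cantorJoin h hA hB
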